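/- **Setting.** Fix $d\ge 0$, real polynomials $q_1,q_2$ in two variables and $B,b\in\mathbb N$. Let $\mathcal X=\mathcal Y=[-1,1]^d$ and let $\mathscr K:\mathcal X\times\mathcal Y\to\mathbb R$ be a kernel. Let $\overline X,\overline Y\subset[-1,1]^d$ be tensor grids of Chebyshev nodes of the first kind (in one dimension, $\bar x_k=\cos\frac{(2k-1)\pi}{2m}$, $k=1,\dots,m$, with weights $w_k=\frac{\pi}{m}\sin\frac{(2k-1)\pi}{2m}$), with at least one node in each direction, product weights $\overline W_X,\overline W_Y$, and tensor Lagrange basis functions $S_k$, $T_l$. The numbers of nodes may differ between directions and between the grids. Put $r_0=\min(|\overline X|,|\overline Y|)$, assume that $\max(|\overline X|,|\overline Y|)\le B\,r_0^{\,b}$, and let $$K_w=\operatorname{diag}(\overline W_X)^{1/2}\,\mathscr K(\overline X,\overline Y)\,\operatorname{diag}(\overline W_Y)^{1/2}.$$ A *strong rank-revealing QR factorization with $k$ pivots* of a matrix $A$ with $n$ columns is a factorization $A\Pi=[Q_1\;Q_2]\begin{bmatrix}R_{11}&R_{12}\\0&R_{22}\end{bmatrix}$, with $\Pi$ a permutation,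 $Q$ orthogonal, $R$ upper triangular and $R_{11}\in\mathbb R^{k\times k}$ invertible, such that, with $A_1$ the $k$ selected columns, $T=R_{11}^{-1}R_{12}$ and $E=A\Pi-A_1[I\;T]$, $$\sigma_i(A)\le q_1(n,k)\,\sigma_i(A_1)\ (1\le i\le k),\qquad \sigma_j(E)\le q_1(n,k)\,\sigma_{k+j}(A)\ (j\ge1),\qquad \|T\|_F\le q_2(n,k).$$ Let $\widehat Y\subset\overline Y$, $|\widehat Y|=r_1$, be the points of the columns that such a factorization of $K_w$ selects (with interpolation operator $\widecheck T^\top$), and let $\widehat X\subset\overline X$, $|\widehat X|=r_1$, be the points that such a factorization of the transpose of these columns of $K_w$ selects (with interpolation operator $\widecheck S^\top$). With $\hat K_w$ the block of $K_w$ at $\widehat X\times\widehat Y$, and the selected rows and columns ordered first, put $$E_{\mathrm{QR}}=K_w-\begin{bmatrix}I\\ \widecheck S\end{bmatrix}\hat K_w\begin{bmatrix}I&\widecheck T^\top\end{bmatrix},\qquad \epsilon=\|E_{\mathrm{QR}}\|_2 .$$ Assume that for some $\delta\le\epsilon$ $$\Big|\mathscr K(x,y)-\sum_{k,l}S_k(x)\,\mathscr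 K(\bar x_k,\bar y_l)\,T_l(y)\Big|\le\delta\qquad\text{for all }x\in\mathcal X,\ y\in\mathcal Y .$$ **Lemma 4.** There are a polynomial $q(r_0,r_1)$ and a constant $C>0$, which depend only on $d,q_1,q_2,B,b$ (in particular not on $\mathscr K$, the grids, $r_1$, $\delta$, $\epsilon$ or the conditioning of $\mathscr K(\widehat X,\widehat Y)$), such that in every situation as above $\mathscr K(\widehat X,\widehat Y)$ is invertible and, for all $x\in\mathcal X$, $y\in\mathcal Y$, $$\|\mathscr K(x,\widehat Y)\,\mathscr K(\widehat X,\widehat Y)^{-1}\|_2\le C\,q(r_0,r_1),\qquad \|\mathscr K(\widehat X,\widehat Y)^{-1}\,\mathscr K(\widehat X,y)\|_2\le C\,q(r_0,r_1).$$ Moreover the condition number $\kappa_2(A)=\|A\|_2\|A^{-1}\|_2$ of $\mathscr K(\widehat X,\widehat Y)$ is at most of order $\epsilon^{-1}$: $$\epsilon\;\kappa_2\big(\mathscr K(\widehat X,\widehat Y)\big)\le C\,q(r_0,r_1)\,\|\mathscr K(\widehat X,\widehat Y)\|_2 .$$ -/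

import Mathlib

open scoped Matrix.Norms.L2Operator

noncomputable section

namespace SkelInterp

/-! ### Chebyshev grids, weights and interpolation on `[-1,1]^d`

Indices start from `0`, so `2k-1` for `k = 1, …, m` becomes `2k+1` for `k : Fin m`. -/

/-- The Chebyshev nodes of the first kind on `[-1,1]`. -/
def chebNode (m : ℕ) (k : Fin m) : ℝ :=
  Real.cos ((2 * (k : ℝ) + 1) / (2 * (m : ℝ)) * Real.pi)

/-- The integration weights of the Chebyshev nodes of the first kind. -/
def chebWeight (m : ℕ) (k : Fin m) : ℝ :=
  Real.pi / (m : ℝ) * Real.sin ((2 * (k : ℝ) + 1) / (2 * (m : ℝ)) * Real.pi)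

/-- Index set of a tensor grid with `m i` nodes in direction `i`. -/
abbrev Grid {d : ℕ} (m : Fin d → ℕ) : Type := (i : Fin d) → Fin (m i)

/-- The points of the tensor grid of Chebyshev nodes. -/
def gridPoint {d : ℕ} (m : Fin d → ℕ) (k : Grid m) : Fin d → ℝ :=
  fun i => chebNode (m i) (k i)

/-- The integration weights of the tensor grid. -/
def gridWeight {d : ℕ} (m : Fin d → ℕ) (k : Grid m) : ℝ :=
  ∏ i, chebWeight (m i) (k i)

/-- The Lagrange basis function of the grid point with index `k`, evaluated at `x`. -/
def gridLagrange {d : ℕ} (m : Fin d → ℕ) (k : Grid m) (x : Fin d → ℝ) : ℝ :=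
  ∏ i, (Lagrange.basis Finset.univ (chebNode (m i)) (k i)).eval (x i)

/-- The cube `[-1,1]^d`. -/
def cube (d : ℕ) : Set (Fin d → ℝ) := {x | ∀ i, x i ∈ Set.Icc (-1 : ℝ) 1}

/-- The matrix `K(X, Y)` of a kernel at two finite families of points. -/
def kernelMatrix {d : ℕ} {ι κ : Type} (K : (Fin d → ℝ) → (Fin d → ℝ) → ℝ)
    (X : ι → Fin d → ℝ) (Y : κ → Fin d → ℝ) : Matrix ι κ ℝ :=
  Matrix.of fun i j => K (X i) (Y j)

/-- The error `E_INT(x, y)` of tensor Chebyshev interpolation of the kernel. -/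
def interpError {d : ℕ} (K : (Fin d → ℝ) → (Fin d → ℝ) → ℝ) (m n : Fin d → ℕ)
    (x y : Fin d → ℝ) : ℝ :=
  K x y - ∑ k : Grid m, ∑ l : Grid n,
    gridLagrange m k x * K (gridPoint m k) (gridPoint n l) * gridLagrange n l y

/-- The weighted node matrix `K_w = diag(W_X)^{1/2} K(X, Y) diag(W_Y)^{1/2}` on the grids. -/
def weightedMatrix {d : ℕ} (K : (Fin d → ℝ) → (Fin d → ℝ) → ℝ) (m n : Fin d → ℕ) :
    Matrix (Grid m) (Grid n) ℝ :=
  Matrix.diagonal (fun k => Real.sqrt (gridWeight m k)) *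
    kernelMatrix K (gridPoint m) (gridPoint n) *
    Matrix.diagonal (fun l => Real.sqrt (gridWeight n l))

/-! ### Strong rank-revealing QR factorizations -/

/-- The singular values of a real matrix in decreasing order, starting from index `0`;
they vanish beyond the size of the matrix. -/
def singVal {ι κ : Type} [Fintype ι] [Fintype κ] [DecidableEq κ]
    (A : Matrix ι κ ℝ) (i : ℕ) : ℝ :=
  (Matrix.toEuclideanLin A).singularValues i

/-- The Frobenius norm. -/
def frobNorm {ι κ : Type} [Fintype ι] [Fintype κ] (A : Matrix ι κ ℝ) : ℝ :=
  Real.sqrt (∑ i, ∑ j, A i j ^ 2)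

/-- A column-pivoted QR factorization `A Π = [Q₁ Q₂] [R₁₁ R₁₂; 0 R₂₂]` with `k` pivots.
The number of columns of `A` is `k + p`; orthogonality of `Q` forces the number of rows to be
`k + l`. -/
structure PivotedQR {ι κ : Type} [Fintype ι] [DecidableEq ι]
    (A : Matrix ι κ ℝ) (k : ℕ) where
  /-- number of rows that remain -/
  l : ℕ
  /-- number of columns that are not selected -/
  p : ℕ
  /-- the column permutation; the selected columns come first -/
  perm : Fin k ⊕ Fin p ≃ κ
  Q : Matrix ι (Fin k ⊕ Fin l) ℝ
  R₁₁ : Matrix (Fin k) (Fin k) ℝ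
  R₁₂ : Matrix (Fin k) (Fin p) ℝ
  R₂₂ : Matrix (Fin l) (Fin p) ℝ
  orth_left : Q.transpose * Q = 1
  orth_right : Q * Q.transpose = 1
  upper₁₁ : ∀ i j : Fin k, j < i → R₁₁ i j = 0
  upper₂₂ : ∀ (i : Fin l) (j : Fin p), (j : ℕ) < (i : ℕ) → R₂₂ i j = 0
  factor : A.submatrix id perm = Q * Matrix.fromBlocks R₁₁ R₁₂ 0 R₂₂

namespace PivotedQR

variable {ι κ : Type} [Fintype ι] [DecidableEq ι] {A : Matrix ι κ ℝ} {k : ℕ}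

/-- Indices of the selected columns. -/
def sel (F : PivotedQR A k) (i : Fin k) : κ := F.perm (Sum.inl i)

/-- The selected columns `A₁`. -/
def cols (F : PivotedQR A k) : Matrix ι (Fin k) ℝ := A.submatrix id F.sel

/-- The interpolation operator `T = R₁₁⁻¹ R₁₂`. -/
def interp (F : PivotedQR A k) : Matrix (Fin k) (Fin F.p) ℝ := F.R₁₁⁻¹ * F.R₁₂

/-- The error `E = A Π - A₁ [I T]`. -/
def err (F : PivotedQR A k) : Matrix ι (Fin k ⊕ Fin F.p) ℝ :=
  A.submatrix id F.perm - F.cols * Matrix.fromCols (1 : Matrix (Fin k) (Fin k) ℝ) F.interp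

/-- The factorization is a *strong* rank-revealing one, with polynomials `q₁(n, k)` and
`q₂(n, k)`, where `n` is the number of columns of `A`:
`σᵢ(A₁) ≥ σᵢ(A) / q₁`, `σⱼ(E) ≤ σ_{k+j}(A) q₁` and `‖T‖_F ≤ q₂`. -/
structure IsStrong [Fintype κ] [DecidableEq κ] (F : PivotedQR A k)
    (q₁ q₂ : MvPolynomial (Fin 2) ℝ) : Prop where
  isUnit : IsUnit F.R₁₁
  lower : ∀ i < k, singVal A i ≤
    MvPolynomial.eval ![(Fintype.card κ : ℝ), (k : ℝ)] q₁ * singVal F.cols i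
  upper : ∀ j, singVal F.err j ≤
    singVal A (k + j) * MvPolynomial.eval ![(Fintype.card κ : ℝ), (k : ℝ)] q₁
  interp_le : frobNorm F.interp ≤ MvPolynomial.eval ![(Fintype.card κ : ℝ), (k : ℝ)] q₂

end PivotedQR

/-! ### Skeletonized interpolation -/

/-- The skeletonization (CUR decomposition) of `K_w` by two successive strong rank-revealing QR
factorizations with `r₁` pivots: the first selects columns of `K_w`, the second selects rows of
the selected columns. -/
structure Skeleton {d : ℕ} (K : (Fin d → ℝ) → (Fin d → ℝ) → ℝ) (m n : Fin d → ℕ) (r₁ : ℕ)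
    (q₁ q₂ : MvPolynomial (Fin 2) ℝ) where
  colQR : PivotedQR (weightedMatrix K m n) r₁
  colQR_strong : colQR.IsStrong q₁ q₂
  rowQR : PivotedQR colQR.cols.transpose r₁
  rowQR_strong : rowQR.IsStrong q₁ q₂

namespace Skeleton

variable {d : ℕ} {K : (Fin d → ℝ) → (Fin d → ℝ) → ℝ} {m n : Fin d → ℕ} {r₁ : ℕ}
  {q₁ q₂ : MvPolynomial (Fin 2) ℝ}

/-- The selected points `X̂`. -/
def Xhat (s : Skeleton K m n r₁ q₁ q₂) (i : Fin r₁) : Fin d → ℝ := gridPoint m (s.rowQR.sel i)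

/-- The selected points `Ŷ`. -/
def Yhat (s : Skeleton K m n r₁ q₁ q₂) (j : Fin r₁) : Fin d → ℝ := gridPoint n (s.colQR.sel j)

/-- The error `E_QR = Π_rᵀ K_w Π_c - [I; S] K̂_w [I Tᵀ]`, where `K̂_w` is the selected
`r₁ × r₁` block of `K_w`. -/
def errQR (s : Skeleton K m n r₁ q₁ q₂) :
    Matrix (Fin r₁ ⊕ Fin s.rowQR.p) (Fin r₁ ⊕ Fin s.colQR.p) ℝ :=
  (weightedMatrix K m n).submatrix s.rowQR.perm s.colQR.perm -
    Matrix.fromRows (1 : Matrix (Fin r₁) (Fin r₁) ℝ) s.rowQR.interp.transpose *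
      (weightedMatrix K m n).submatrix s.rowQR.sel s.colQR.sel *
      Matrix.fromCols (1 : Matrix (Fin r₁) (Fin r₁) ℝ) s.colQR.interp

/-- The accuracy `ε = ‖E_QR‖₂`. -/
def eps (s : Skeleton K m n r₁ q₁ q₂) : ℝ := ‖s.errQR‖

/-- The matrix `K(X̂, Ŷ)`. -/
def core (s : Skeleton K m n r₁ q₁ q₂) : Matrix (Fin r₁) (Fin r₁) ℝ :=
  kernelMatrix K s.Xhat s.Yhat

/-- The row vector `K(x, Ŷ) K(X̂, Ŷ)⁻¹`. -/
def leftOp (s : Skeleton K m n r₁ q₁ q₂) (x : Fin d → ℝ) : Matrix Unit (Fin r₁) ℝ :=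
  kernelMatrix K (fun _ : Unit => x) s.Yhat * s.core⁻¹

/-- The column vector `K(X̂, Ŷ)⁻¹ K(X̂, y)`. -/
def rightOp (s : Skeleton K m n r₁ q₁ q₂) (y : Fin d → ℝ) : Matrix (Fin r₁) Unit ℝ :=
  s.core⁻¹ * kernelMatrix K s.Xhat (fun _ : Unit => y)

end Skeleton

/-- The condition number of a square matrix in the spectral norm. -/
def condNumber {r : ℕ} (A : Matrix (Fin r) (Fin r) ℝ) : ℝ := ‖A‖ * ‖A⁻¹‖

/-- The interpolation rank `r₀`, the smaller one of the two grid sizes. -/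
def interpRank {d : ℕ} (m n : Fin d → ℕ) : ℕ :=
  min (Fintype.card (Grid m)) (Fintype.card (Grid n))

end SkelInterp

end

namespace SkelInterp

theorem sin_half_mul_dirichlet (M : ℕ) (φ : ℝ) :
    Real.sin (φ / 2) * (1 + 2 * ∑ j ∈ Finset.range M, Real.cos ((j + 1) * φ)) =
      Real.sin (((M : ℝ) + 1 / 2) * φ) := by
  induction M with
  | zero => simp; congr 1; ring
  | succ M ih =>
    rw [Finset.sum_range_succ]
    have h : Real.sin (((M + 1 : ℕ) + 1 / 2 : ℝ) * φ) - Real.sin (((M : ℝ) + 1 / 2) * φ) =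
        2 * Real.sin (φ / 2) * Real.cos ((M + 1) * φ) := by
      rw [Real.sin_sub_sin]
      push_cast
      ring_nf
    linear_combination ih - h

/-- The Dirichlet kernel at the multiples of `π / m` that are not multiples of `2π`. -/
theorem dirichlet_mul_pi_div {M : ℕ} {s : ℤ} (hs : s ≠ 0) (hlt : |s| < 2 * (M + 1)) :
    1 + 2 * ∑ j ∈ Finset.range M, Real.cos ((j + 1) * (s * Real.pi / (M + 1))) =
      -(-1 : ℝ) ^ s := by
  set φ : ℝ := s * Real.pi / (M + 1) with hφ
  have hM : (0 : ℝ) < M + 1 := by positivity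
  have hsin : Real.sin (φ / 2) ≠ 0 := by
    intro h
    obtain ⟨z, hz⟩ := Real.sin_eq_zero_iff.1 h
    have h1 : (z : ℝ) * (2 * (M + 1)) = s := by
      rw [hφ] at hz
      field_simp at hz
      linarith
    have h2 : z * (2 * (M + 1)) = s := by exact_mod_cast h1
    rcases eq_or_ne z 0 with rfl | hz0
    · simp at h2; exact hs h2.symm
    · have : 1 ≤ |z| := Int.one_le_abs hz0
      rw [← h2, abs_mul, abs_of_pos (by positivity : (0 : ℤ) < 2 * (M + 1))] at hlt
      nlinarith
  have key := sin_half_mul_dirichlet M φ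
  have h3 : Real.sin (((M : ℝ) + 1 / 2) * φ) = -(-1 : ℝ) ^ s * Real.sin (φ / 2) := by
    have : ((M : ℝ) + 1 / 2) * φ = s * Real.pi - φ / 2 := by rw [hφ]; field_simp; ring
    rw [this, Real.sin_sub, Real.sin_int_mul_pi, Real.cos_int_mul_pi]
    ring
  rw [h3, mul_comm] at key
  exact mul_right_cancel₀ hsin key

theorem chebNode_injective (m : ℕ) : Function.Injective (chebNode m) := by
  intro k l h
  have hm : (0 : ℝ) < m := by exact_mod_cast k.pos
  have hmem : ∀ k : Fin m, (2 * (k : ℝ) + 1) / (2 * (m : ℝ)) * Real.pi ∈ Set.Icc 0 Real.pi := by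
    intro k
    have hk : (k : ℝ) + 1 ≤ m := by exact_mod_cast k.2
    refine ⟨by positivity, ?_⟩
    apply mul_le_of_le_one_left Real.pi_pos.le
    rw [div_le_one (by positivity)]
    linarith
  have := Real.injOn_cos (hmem k) (hmem l) h
  have h2 := mul_right_cancel₀ Real.pi_pos.ne' this
  field_simp at h2
  exact Fin.ext (by exact_mod_cast (by linarith : (k : ℝ) = l))

/-- Discrete orthogonality of the Chebyshev polynomials, summed over the degrees. -/
theorem sum_T_mul_T_chebNode (M : ℕ) (k l : Fin (M + 1)) :
    1 + 2 * ∑ j ∈ Finset.range M, (Polynomial.Chebyshev.T ℝ (j + 1)).eval (chebNode (M + 1) k) *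
      (Polynomial.Chebyshev.T ℝ (j + 1)).eval (chebNode (M + 1) l) =
      if k = l then (M + 1 : ℝ) else 0 := by
  have hM : (0 : ℝ) < M + 1 := by positivity
  have hterm : ∀ j : ℕ, 2 * ((Polynomial.Chebyshev.T ℝ (j + 1)).eval (chebNode (M + 1) k) *
      (Polynomial.Chebyshev.T ℝ (j + 1)).eval (chebNode (M + 1) l)) =
      Real.cos ((j + 1) * (((k : ℤ) - l : ℤ) * Real.pi / (M + 1))) +
      Real.cos ((j + 1) * (((k : ℤ) + l + 1 : ℤ) * Real.pi / (M + 1))) := by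
    intro j
    simp only [chebNode, Polynomial.Chebyshev.T_real_cos]
    rw [← mul_assoc, Real.two_mul_cos_mul_cos]
    push_cast
    congr 2 <;> field_simp <;> ring
  rw [Finset.mul_sum, Finset.sum_congr rfl (fun j _ => hterm j), Finset.sum_add_distrib]
  have hk := k.2
  have hl := l.2
  have h2 := dirichlet_mul_pi_div (M := M) (s := (k : ℤ) + l + 1) (by omega)
    (by rw [abs_lt]; omega)
  split_ifs with hkl
  · subst hkl
    rw [(by rw [← two_mul, zpow_add₀ (by norm_num), zpow_mul]; norm_num :
      (-1 : ℝ) ^ ((k : ℤ) + k + 1) = -1)] at h2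
    simp only [sub_self, Int.cast_zero, zero_mul, zero_div, mul_zero, Real.cos_zero,
      Finset.sum_const, Finset.card_range, nsmul_eq_mul]
    linarith
  · have h1 := dirichlet_mul_pi_div (M := M) (s := (k : ℤ) - l)
      (fun h => hkl (Fin.ext (by omega))) (by rw [abs_lt]; omega)
    have h3 : (-1 : ℝ) ^ ((k : ℤ) + l + 1) = -(-1 : ℝ) ^ ((k : ℤ) - l) := by
      rw [show (k : ℤ) + l + 1 = (k - l) + 2 * l + 1 by ring, zpow_add₀ (by norm_num),
        zpow_add₀ (by norm_num), zpow_mul]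
      norm_num
    rw [h3] at h2
    linarith

theorem chebNode_basis_eq (M : ℕ) (k : Fin (M + 1)) :
    Lagrange.basis Finset.univ (chebNode (M + 1)) k =
      Polynomial.C ((M + 1 : ℝ)⁻¹) * (1 + ∑ j ∈ Finset.range M,
        Polynomial.C (2 * (Polynomial.Chebyshev.T ℝ (j + 1)).eval (chebNode (M + 1) k)) *
          Polynomial.Chebyshev.T ℝ (j + 1)) := by
  have hM : (M + 1 : ℝ) ≠ 0 := by positivity
  refine Polynomial.eq_of_degrees_lt_of_eval_index_eq Finset.univ
    (chebNode_injective (M + 1)).injOn ?_ ?_ ?_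
  · rw [Lagrange.degree_basis (chebNode_injective (M + 1)).injOn (Finset.mem_univ k)]
    simp only [Finset.card_univ, Fintype.card_fin]
    exact_mod_cast Nat.lt_succ_self M
  · rw [Polynomial.degree_C_mul (inv_ne_zero hM)]
    simp only [Finset.card_univ, Fintype.card_fin]
    refine (Polynomial.degree_add_le _ _).trans_lt (max_lt ?_ ?_)
    · rw [Polynomial.degree_one]
      exact_mod_cast Nat.succ_pos M
    · refine (Polynomial.degree_sum_le _ _).trans_lt ?_
      rw [Finset.sup_lt_iff (WithBot.bot_lt_coe _)]
      intro j hj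
      rw [Polynomial.C_mul']
      refine (Polynomial.degree_smul_le _ _).trans_lt ?_
      rw [Polynomial.Chebyshev.degree_T]
      have := Finset.mem_range.1 hj
      exact_mod_cast (by omega : ((j : ℤ) + 1).natAbs < M + 1)
  · intro l _
    have h := sum_T_mul_T_chebNode M k l
    simp only [Polynomial.eval_mul, Polynomial.eval_C, Polynomial.eval_add, Polynomial.eval_one,
      Polynomial.eval_finsetSum, mul_assoc, ← Finset.mul_sum]
    rw [h]
    rcases eq_or_ne k l with rfl | hkl
    · rw [Lagrange.eval_basis_self (chebNode_injective (M + 1)).injOn (Finset.mem_univ k)]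
      simp [hM]
    · rw [Lagrange.eval_basis_of_ne hkl (Finset.mem_univ l)]
      simp [hkl]

theorem chebNode_mem_Icc (m : ℕ) (k : Fin m) : chebNode m k ∈ Set.Icc (-1 : ℝ) 1 :=
  ⟨Real.neg_one_le_cos _, Real.cos_le_one _⟩

theorem abs_eval_T_le_one (n : ℤ) {x : ℝ} (hx : x ∈ Set.Icc (-1 : ℝ) 1) :
    |(Polynomial.Chebyshev.T ℝ n).eval x| ≤ 1 := by
  rw [← Real.cos_arccos hx.1 hx.2, Polynomial.Chebyshev.T_real_cos]
  exact Real.abs_cos_le_one _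

/-- The Lagrange basis functions of the Chebyshev nodes are bounded by `2` on `[-1,1]`. -/
theorem abs_chebNode_basis_le (m : ℕ) (k : Fin m) {x : ℝ} (hx : x ∈ Set.Icc (-1 : ℝ) 1) :
    |(Lagrange.basis Finset.univ (chebNode m) k).eval x| ≤ 2 := by
  obtain ⟨M, rfl⟩ : ∃ M, m = M + 1 := ⟨m - 1, by have := k.pos; omega⟩
  have hM : (0 : ℝ) < M + 1 := by positivity
  rw [chebNode_basis_eq]
  simp only [Polynomial.eval_mul, Polynomial.eval_C, Polynomial.eval_add, Polynomial.eval_one,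
    Polynomial.eval_finsetSum]
  rw [abs_mul, abs_of_pos (inv_pos.2 hM), inv_mul_le_iff₀ hM]
  refine (abs_add_le _ _).trans ?_
  have : |∑ j ∈ Finset.range M, 2 * (Polynomial.Chebyshev.T ℝ (j + 1)).eval (chebNode (M + 1) k) *
      (Polynomial.Chebyshev.T ℝ (j + 1)).eval x| ≤ ∑ j ∈ Finset.range M, (2 : ℝ) := by
    refine (Finset.abs_sum_le_sum_abs _ _).trans (Finset.sum_le_sum fun j _ => ?_)
    rw [abs_mul, abs_mul, abs_two]
    have h1 := abs_eval_T_le_one (j + 1) (chebNode_mem_Icc (M + 1) k)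
    have h2 := abs_eval_T_le_one (j + 1) hx
    have := mul_le_one₀ h1 (abs_nonneg _) h2
    linarith
  simp at this ⊢
  linarith

theorem abs_gridLagrange_le {d : ℕ} (m : Fin d → ℕ) (k : Grid m) {x : Fin d → ℝ}
    (hx : x ∈ cube d) : |gridLagrange m k x| ≤ 2 ^ d := by
  rw [gridLagrange, Finset.abs_prod]
  calc _ ≤ ∏ _i : Fin d, (2 : ℝ) :=
        Finset.prod_le_prod (fun _ _ => abs_nonneg _)
          (fun i _ => abs_chebNode_basis_le (m i) (k i) (hx i))
    _ = 2 ^ d := by simp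

theorem gridPoint_mem_cube {d : ℕ} (m : Fin d → ℕ) (k : Grid m) : gridPoint m k ∈ cube d :=
  fun i => chebNode_mem_Icc (m i) (k i)

theorem gridLagrange_gridPoint {d : ℕ} (m : Fin d → ℕ) (k l : Grid m) :
    gridLagrange m k (gridPoint m l) = if k = l then 1 else 0 := by
  split_ifs with h
  · subst h
    exact Finset.prod_eq_one fun i _ =>
      Lagrange.eval_basis_self (chebNode_injective _).injOn (Finset.mem_univ _)
  · obtain ⟨i, hi⟩ := Function.ne_iff.1 h
    exact Finset.prod_eq_zero (Finset.mem_univ i)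
      (Lagrange.eval_basis_of_ne hi (Finset.mem_univ _))

theorem chebWeight_le_pi (m : ℕ) (k : Fin m) : chebWeight m k ≤ Real.pi := by
  have hm : (1 : ℝ) ≤ m := by exact_mod_cast k.pos
  have := Real.sin_le_one ((2 * (k : ℝ) + 1) / (2 * (m : ℝ)) * Real.pi)
  have h1 : Real.pi / m ≤ Real.pi := div_le_self Real.pi_pos.le hm
  have h2 : 0 ≤ Real.pi / m := by positivity
  rw [chebWeight]
  nlinarith

theorem inv_sq_le_chebWeight (m : ℕ) (k : Fin m) : ((m : ℝ) ^ 2)⁻¹ ≤ chebWeight m k := by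
  have hm : (0 : ℝ) < m := by exact_mod_cast k.pos
  have hk : (k : ℝ) + 1 ≤ m := by exact_mod_cast k.2
  have hsin : (m : ℝ)⁻¹ ≤ Real.sin ((2 * (k : ℝ) + 1) / (2 * (m : ℝ)) * Real.pi) := by
    have jordan : ∀ t : ℝ, (2 * (m : ℝ))⁻¹ ≤ t → t ≤ 1 / 2 →
        (m : ℝ)⁻¹ ≤ Real.sin (t * Real.pi) := by
      intro t h1 h2
      have h0 : 0 ≤ t := le_trans (by positivity) h1
      have h3 := Real.mul_le_sin (x := t * Real.pi) (by positivity)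
        (by nlinarith [Real.pi_pos])
      have h4 : 2 / Real.pi * (t * Real.pi) = 2 * t := by field_simp
      rw [mul_inv] at h1
      linarith
    by_cases h : (2 * (k : ℝ) + 1) / (2 * (m : ℝ)) ≤ 1 / 2
    · refine jordan _ ?_ h
      rw [inv_eq_one_div]
      gcongr
      linarith [(k : ℕ).cast_nonneg (α := ℝ)]
    · rw [← Real.sin_pi_sub]
      have : Real.pi - (2 * (k : ℝ) + 1) / (2 * (m : ℝ)) * Real.pi =
          (1 - (2 * (k : ℝ) + 1) / (2 * (m : ℝ))) * Real.pi := by ring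
      rw [this]
      refine jordan _ ?_ (by linarith)
      field_simp
      linarith
  rw [chebWeight, sq, mul_inv]
  have hpi : (m : ℝ)⁻¹ ≤ Real.pi / m := by
    rw [inv_eq_one_div]
    gcongr
    linarith [Real.pi_gt_three]
  exact mul_le_mul hpi hsin (by positivity) (by positivity)

theorem gridWeight_le {d : ℕ} (m : Fin d → ℕ) (k : Grid m) : gridWeight m k ≤ Real.pi ^ d := by
  calc gridWeight m k ≤ ∏ _i : Fin d, Real.pi :=
        Finset.prod_le_prod
          (fun i _ => le_trans (by positivity) (inv_sq_le_chebWeight (m i) (k i)))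
          (fun i _ => chebWeight_le_pi (m i) (k i))
    _ = _ := by simp

theorem inv_card_sq_le_gridWeight {d : ℕ} (m : Fin d → ℕ) (k : Grid m) :
    ((Fintype.card (Grid m) : ℝ) ^ 2)⁻¹ ≤ gridWeight m k := by
  have : ((Fintype.card (Grid m) : ℝ) ^ 2)⁻¹ = ∏ i, ((m i : ℝ) ^ 2)⁻¹ := by
    rw [Fintype.card_pi]
    push_cast
    simp [Finset.prod_pow]
  rw [this]
  exact Finset.prod_le_prod (fun i _ => by positivity) fun i _ => inv_sq_le_chebWeight (m i) (k i)

theorem gridWeight_pos {d : ℕ} (m : Fin d → ℕ) (k : Grid m) : 0 < gridWeight m k :=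
  have : Nonempty (Grid m) := ⟨k⟩
  lt_of_lt_of_le (by positivity) (inv_card_sq_le_gridWeight m k)

theorem sqrt_gridWeight_le {d : ℕ} (m : Fin d → ℕ) (k : Grid m) :
    Real.sqrt (gridWeight m k) ≤ Real.pi ^ d := by
  rw [Real.sqrt_le_left (by positivity)]
  have h1 : (1 : ℝ) ≤ Real.pi ^ d := one_le_pow₀ (by linarith [Real.pi_gt_three])
  nlinarith [gridWeight_le m k]

theorem inv_sqrt_gridWeight_le {d : ℕ} (m : Fin d → ℕ) (k : Grid m) :
    (Real.sqrt (gridWeight m k))⁻¹ ≤ Fintype.card (Grid m) := by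
  have : Nonempty (Grid m) := ⟨k⟩
  rw [inv_le_comm₀ (Real.sqrt_pos.2 (gridWeight_pos m k)) (by positivity)]
  apply Real.le_sqrt_of_sq_le
  rw [inv_pow]
  exact inv_card_sq_le_gridWeight m k

end SkelInterp

namespace LinearMap

variable {𝕜 : Type*} [RCLike 𝕜]
  {E : Type*} [NormedAddCommGroup E] [InnerProductSpace 𝕜 E] [FiniteDimensional 𝕜 E]
  {F : Type*} [NormedAddCommGroup F] [InnerProductSpace 𝕜 F] [FiniteDimensional 𝕜 F]

/-- The norm of `T v` in terms of the singular values and the right singular vectors. -/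
theorem norm_sq_apply_eq_sum_singularValues (T : E →ₗ[𝕜] F) (v : E) :
    ‖T v‖ ^ 2 = ∑ i : Fin (Module.finrank 𝕜 E), T.singularValues i ^ 2 *
      ‖inner 𝕜 (T.isSymmetric_adjoint_comp_self.eigenvectorBasis rfl i) v‖ ^ 2 := by
  set b := T.isSymmetric_adjoint_comp_self.eigenvectorBasis rfl with hb
  have h1 : inner 𝕜 (T v) (T v) = inner 𝕜 v ((adjoint T ∘ₗ T) v) := by
    rw [comp_apply, adjoint_inner_right]
  have h2 : ∀ i, inner 𝕜 (b i) ((adjoint T ∘ₗ T) v) =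
      ((T.singularValues i ^ 2 : ℝ) : 𝕜) * inner 𝕜 (b i) v := by
    intro i
    rw [← T.isSymmetric_adjoint_comp_self (b i) v, hb,
      T.isSymmetric_adjoint_comp_self.apply_eigenvectorBasis rfl i, inner_smul_left,
      T.sq_singularValues_fin rfl i]
    simp
  have h3 : ((‖T v‖ ^ 2 : ℝ) : 𝕜) = ((∑ i : Fin (Module.finrank 𝕜 E), T.singularValues i ^ 2 *
      ‖inner 𝕜 (b i) v‖ ^ 2 : ℝ) : 𝕜) := by
    push_cast
    rw [← inner_self_eq_norm_sq_to_K, h1, ← b.sum_inner_mul_inner]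
    refine Finset.sum_congr rfl fun i _ => ?_
    rw [h2, ← inner_conj_symm v (b i), mul_left_comm, RCLike.conj_mul]
    push_cast
    rfl
  exact_mod_cast h3

theorem norm_apply_le_singularValues_zero (T : E →ₗ[𝕜] F) (v : E) :
    ‖T v‖ ≤ T.singularValues 0 * ‖v‖ := by
  refine le_of_sq_le_sq ?_ (mul_nonneg (T.singularValues_nonneg 0) (norm_nonneg v))
  rw [norm_sq_apply_eq_sum_singularValues, mul_pow,
    ← (T.isSymmetric_adjoint_comp_self.eigenvectorBasis rfl).sum_sq_norm_inner_right v,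
    Finset.mul_sum]
  refine Finset.sum_le_sum fun i _ => ?_
  have := T.singularValues_antitone (Nat.zero_le i)
  have := T.singularValues_nonneg i
  gcongr

theorem singularValues_mul_norm_le_norm_apply (T : E →ₗ[𝕜] F) {k : ℕ}
    (hk : Module.finrank 𝕜 E ≤ k + 1) (v : E) : T.singularValues k * ‖v‖ ≤ ‖T v‖ := by
  refine le_of_sq_le_sq ?_ (norm_nonneg _)
  rw [norm_sq_apply_eq_sum_singularValues, mul_pow,
    ← (T.isSymmetric_adjoint_comp_self.eigenvectorBasis rfl).sum_sq_norm_inner_right v,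
    Finset.mul_sum]
  refine Finset.sum_le_sum fun i _ => ?_
  have := T.singularValues_antitone (show (i : ℕ) ≤ k by omega)
  have := T.singularValues_nonneg k
  gcongr

end LinearMap

namespace SkelInterp

theorem abs_entry_le_frobNorm {ι κ : Type} [Fintype ι] [Fintype κ] (A : Matrix ι κ ℝ) (i : ι)
    (j : κ) : |A i j| ≤ frobNorm A := by
  apply Real.abs_le_sqrt
  calc A i j ^ 2 ≤ ∑ j, A i j ^ 2 :=
        Finset.single_le_sum (f := fun j => A i j ^ 2) (fun _ _ => sq_nonneg _)
          (Finset.mem_univ j)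
    _ ≤ _ := Finset.single_le_sum (f := fun i => ∑ j, A i j ^ 2)
          (fun _ _ => Finset.sum_nonneg fun _ _ => sq_nonneg _) (Finset.mem_univ i)

section Norms

variable {ι κ : Type} [Fintype ι] [Fintype κ] [DecidableEq κ]

theorem norm_toLp_mulVec_le (A : Matrix ι κ ℝ) (v : κ → ℝ) :
    ‖WithLp.toLp 2 (A.mulVec v)‖ ≤ ‖A‖ * ‖WithLp.toLp 2 v‖ :=
  Matrix.l2_opNorm_mulVec A (WithLp.toLp 2 v)

theorem norm_le_of_forall_mulVec {A : Matrix ι κ ℝ} {c : ℝ} (hc : 0 ≤ c)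
    (h : ∀ v : κ → ℝ, ‖WithLp.toLp 2 (A.mulVec v)‖ ≤ c * ‖WithLp.toLp 2 v‖) : ‖A‖ ≤ c := by
  rw [Matrix.l2_opNorm_def]
  exact ContinuousLinearMap.opNorm_le_bound _ hc fun v => h v.ofLp

theorem singVal_nonneg (A : Matrix ι κ ℝ) (i : ℕ) : 0 ≤ singVal A i :=
  LinearMap.singularValues_nonneg _ i

theorem singVal_antitone (A : Matrix ι κ ℝ) : Antitone (singVal A) :=
  LinearMap.singularValues_antitone _

theorem norm_le_singVal_zero (A : Matrix ι κ ℝ) : ‖A‖ ≤ singVal A 0 :=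
  norm_le_of_forall_mulVec (singVal_nonneg A 0) fun v =>
    (Matrix.toEuclideanLin A).norm_apply_le_singularValues_zero (WithLp.toLp 2 v)

theorem singVal_mul_norm_le (A : Matrix ι κ ℝ) {k : ℕ} (hk : Fintype.card κ ≤ k + 1)
    (v : κ → ℝ) : singVal A k * ‖WithLp.toLp 2 v‖ ≤ ‖WithLp.toLp 2 (A.mulVec v)‖ :=
  (Matrix.toEuclideanLin A).singularValues_mul_norm_le_norm_apply (by simpa using hk)
    (WithLp.toLp 2 v)

theorem norm_submatrix_left_le {ι' : Type} [Fintype ι'] (A : Matrix ι κ ℝ) (e : ι' ≃ ι) :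
    ‖A.submatrix e id‖ ≤ ‖A‖ := by
  refine norm_le_of_forall_mulVec (norm_nonneg _) fun v => ?_
  refine le_trans (le_of_eq ?_) (norm_toLp_mulVec_le A v)
  rw [EuclideanSpace.norm_eq, EuclideanSpace.norm_eq]
  congr 1
  exact Fintype.sum_equiv e _ _ fun i => rfl

theorem abs_entry_le_norm (A : Matrix ι κ ℝ) (i : ι) (j : κ) : |A i j| ≤ ‖A‖ := by
  have h := norm_toLp_mulVec_le A (Pi.single j 1)
  have h1 : ‖WithLp.toLp 2 (Pi.single j (1 : ℝ) : κ → ℝ)‖ = 1 := by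
    simp
  rw [h1, mul_one] at h
  refine le_trans ?_ h
  have := PiLp.norm_apply_le (WithLp.toLp 2 (A.mulVec (Pi.single j 1))) i
  simpa using this

theorem norm_le_card_mul_of_abs_entry_le (A : Matrix ι κ ℝ) {c : ℝ} (hc : 0 ≤ c)
    (h : ∀ i j, |A i j| ≤ c) : ‖A‖ ≤ Fintype.card ι * Fintype.card κ * c := by
  refine norm_le_of_forall_mulVec (by positivity) fun v => ?_
  have hnorm : ∀ w : ι → ℝ, ‖WithLp.toLp 2 w‖ ≤ ∑ i, |w i| := by
    intro w
    rw [EuclideanSpace.norm_eq, Real.sqrt_le_left (Finset.sum_nonneg fun _ _ => abs_nonneg _)]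
    exact Finset.sum_sq_le_sq_sum_of_nonneg fun i _ => abs_nonneg _
  refine (hnorm _).trans ?_
  calc ∑ i, |A.mulVec v i| ≤ ∑ _i : ι, ∑ _j : κ, c * ‖WithLp.toLp 2 v‖ := by
        refine Finset.sum_le_sum fun i _ => ?_
        refine (Finset.abs_sum_le_sum_abs _ _).trans (Finset.sum_le_sum fun j _ => ?_)
        rw [abs_mul]
        exact mul_le_mul (h i j) (PiLp.norm_apply_le (WithLp.toLp 2 v) j) (abs_nonneg _) hc
    _ = _ := by simp; ring

end Norms

/-- The absolute value of a product of matrices, entrywise. -/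
theorem abs_mul_apply_le {ι κ μ : Type} [Fintype κ] (A : Matrix ι κ ℝ) (B : Matrix κ μ ℝ)
    {a b : ℝ} (i : ι) (j : μ) (ha : ∀ k, |A i k| ≤ a) (hb : ∀ k, |B k j| ≤ b) :
    |(A * B) i j| ≤ Fintype.card κ * (a * b) := by
  rw [Matrix.mul_apply]
  refine (Finset.abs_sum_le_sum_abs _ _).trans ?_
  calc ∑ k, |A i k * B k j| ≤ ∑ _k : κ, a * b := by
        refine Finset.sum_le_sum fun k _ => ?_
        rw [abs_mul]
        exact mul_le_mul (ha k) (hb k) (abs_nonneg _) ((abs_nonneg _).trans (ha k))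
    _ = _ := by simp

namespace PivotedQR

variable {ι κ : Type} [Fintype ι] [DecidableEq ι] {A : Matrix ι κ ℝ} {k : ℕ}

theorem card_rows (F : PivotedQR A k) : Fintype.card ι = k + F.l := by
  have h1 := Matrix.rank_one (R := ℝ) (n := ι)
  have h2 := Matrix.rank_one (R := ℝ) (n := Fin k ⊕ Fin F.l)
  rw [← F.orth_right] at h1
  rw [← F.orth_left] at h2
  have h3 := (Matrix.rank_mul_le_left F.Q F.Q.transpose).trans (Matrix.rank_le_card_width F.Q)
  have h4 := (Matrix.rank_mul_le_right F.Q.transpose F.Q).trans (Matrix.rank_le_card_height F.Q)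
  simp only [Fintype.card_sum, Fintype.card_fin] at *
  omega

theorem cols_eq (F : PivotedQR A k) :
    F.cols = F.Q * Matrix.fromRows F.R₁₁ (0 : Matrix (Fin F.l) (Fin k) ℝ) := by
  ext i j
  have := congr_fun (congr_fun F.factor i) (Sum.inl j)
  simpa [Matrix.mul_apply, cols, sel] using this

theorem card_cols [Fintype κ] (F : PivotedQR A k) : Fintype.card κ = k + F.p := by
  rw [← Fintype.card_congr F.perm]
  simp

/-- If `A` has exactly `k` rows, then the skeleton reproduces it exactly. -/
theorem err_eq_zero (F : PivotedQR A k) (hι : Fintype.card ι = k) (hR : IsUnit F.R₁₁) :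
    F.err = 0 := by
  have hl : F.l = 0 := by have := F.card_rows; omega
  have : IsEmpty (Fin F.l) := by rw [hl]; infer_instance
  have hdet := (Matrix.isUnit_iff_isUnit_det _).1 hR
  rw [err, F.factor, F.cols_eq, interp, Matrix.mul_assoc, ← Matrix.mul_sub]
  convert Matrix.mul_zero F.Q
  ext i j
  rcases i with i | i
  · rcases j with j | j
    · simp [Matrix.mul_fromCols, Matrix.fromRows_mul]
    · simp [Matrix.mul_fromCols, Matrix.fromRows_mul, ← Matrix.mul_assoc,
        Matrix.mul_nonsing_inv _ hdet]
  · exact isEmptyElim i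

theorem abs_interp_extended_le (F : PivotedQR A k) {t : ℝ} (ht : frobNorm F.interp ≤ t)
    (i : Fin k) (j : Fin k ⊕ Fin F.p) :
    |Matrix.fromCols (1 : Matrix (Fin k) (Fin k) ℝ) F.interp i j| ≤ 1 + t := by
  have h0 : 0 ≤ t := (Real.sqrt_nonneg _).trans ht
  rcases j with j | j
  · simp only [Matrix.fromCols_apply_inl, Matrix.one_apply]
    split_ifs <;> simp <;> linarith
  · simp only [Matrix.fromCols_apply_inr]
    linarith [abs_entry_le_frobNorm F.interp i j]

end PivotedQR

end SkelInterp

namespace SkelInterp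

/-- The polynomial with the absolute values of the coefficients of `p`. -/
noncomputable def absPoly (p : MvPolynomial (Fin 2) ℝ) : MvPolynomial (Fin 2) ℝ :=
  ∑ e ∈ p.support, MvPolynomial.monomial e |p.coeff e|

theorem abs_eval_le_eval_absPoly (p : MvPolynomial (Fin 2) ℝ) {x y : Fin 2 → ℝ}
    (hx : ∀ i, 0 ≤ x i) (hxy : ∀ i, x i ≤ y i) :
    |MvPolynomial.eval x p| ≤ MvPolynomial.eval y (absPoly p) := by
  rw [MvPolynomial.eval_eq, absPoly, map_sum]
  refine (Finset.abs_sum_le_sum_abs _ _).trans (Finset.sum_le_sum fun e _ => ?_)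
  rw [MvPolynomial.eval_monomial, abs_mul, Finsupp.prod, Finset.abs_prod]
  gcongr with i
  rw [abs_pow, abs_of_nonneg (hx i)]
  exact pow_le_pow_left₀ (hx i) (hxy i) _

namespace Skeleton

variable {d : ℕ} {K : (Fin d → ℝ) → (Fin d → ℝ) → ℝ} {m n : Fin d → ℕ} {r₁ : ℕ}
  {q₁ q₂ : MvPolynomial (Fin 2) ℝ}

theorem weightedMatrix_apply (K : (Fin d → ℝ) → (Fin d → ℝ) → ℝ) (m n : Fin d → ℕ)
    (i : Grid m) (j : Grid n) :
    weightedMatrix K m n i j = Real.sqrt (gridWeight m i) * K (gridPoint m i) (gridPoint n j) *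
      Real.sqrt (gridWeight n j) := by
  simp [weightedMatrix, kernelMatrix, Matrix.mul_diagonal, Matrix.diagonal_mul]

/-- The selected block of the weighted matrix. -/
noncomputable def weightedCore (s : Skeleton K m n r₁ q₁ q₂) : Matrix (Fin r₁) (Fin r₁) ℝ :=
  (weightedMatrix K m n).submatrix s.rowQR.sel s.colQR.sel

/-- The square roots of the weights of the selected rows. -/
noncomputable def rowScale (s : Skeleton K m n r₁ q₁ q₂) (i : Fin r₁) : ℝ :=
  Real.sqrt (gridWeight m (s.rowQR.sel i))

/-- The square roots of the weights of the selected columns. -/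
noncomputable def colScale (s : Skeleton K m n r₁ q₁ q₂) (j : Fin r₁) : ℝ :=
  Real.sqrt (gridWeight n (s.colQR.sel j))

/-- The interpolation operator that recovers all rows of the selected columns. -/
noncomputable def rowInterp (s : Skeleton K m n r₁ q₁ q₂) : Matrix (Grid m) (Fin r₁) ℝ :=
  Matrix.of fun i l =>
    Matrix.fromCols (1 : Matrix (Fin r₁) (Fin r₁) ℝ) s.rowQR.interp l (s.rowQR.perm.symm i)

/-- The interpolation operator that recovers all columns. -/
noncomputable def colInterp (s : Skeleton K m n r₁ q₁ q₂) : Matrix (Fin r₁) (Grid n) ℝ :=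
  Matrix.of fun l j =>
    Matrix.fromCols (1 : Matrix (Fin r₁) (Fin r₁) ℝ) s.colQR.interp l (s.colQR.perm.symm j)

theorem rowScale_pos (s : Skeleton K m n r₁ q₁ q₂) (i : Fin r₁) : 0 < s.rowScale i :=
  Real.sqrt_pos.2 (gridWeight_pos _ _)

theorem colScale_pos (s : Skeleton K m n r₁ q₁ q₂) (j : Fin r₁) : 0 < s.colScale j :=
  Real.sqrt_pos.2 (gridWeight_pos _ _)

theorem weightedCore_eq (s : Skeleton K m n r₁ q₁ q₂) :
    s.weightedCore = Matrix.diagonal s.rowScale * s.core * Matrix.diagonal s.colScale := by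
  ext i j
  simp [weightedCore, weightedMatrix_apply, core, kernelMatrix, rowScale, colScale, Xhat, Yhat,
    Matrix.mul_diagonal, Matrix.diagonal_mul]

theorem isUnit_det_weightedCore (s : Skeleton K m n r₁ q₁ q₂) : IsUnit s.weightedCore.det := by
  have h1 : s.weightedCore.transpose = s.rowQR.cols := by
    ext i j
    simp [weightedCore, PivotedQR.cols]
  have h2 : s.rowQR.cols.transpose * s.rowQR.cols = s.rowQR.R₁₁.transpose * s.rowQR.R₁₁ := by
    rw [s.rowQR.cols_eq, Matrix.transpose_mul, Matrix.mul_assoc, ← Matrix.mul_assoc _ s.rowQR.Q,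
      s.rowQR.orth_left, Matrix.one_mul, Matrix.transpose_fromRows, Matrix.fromCols_mul_fromRows]
    simp
  have h3 := congr_arg Matrix.det h2
  rw [Matrix.det_mul, Matrix.det_mul, Matrix.det_transpose, Matrix.det_transpose, ← h1,
    Matrix.det_transpose] at h3
  have h4 := (Matrix.isUnit_iff_isUnit_det _).1 s.rowQR_strong.isUnit
  have h5 := h4.mul h4
  rw [← h3] at h5
  exact isUnit_of_mul_isUnit_left h5

theorem isUnit_core (s : Skeleton K m n r₁ q₁ q₂) : IsUnit s.core := by
  have h := s.isUnit_det_weightedCore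
  rw [weightedCore_eq, Matrix.det_mul, Matrix.det_mul] at h
  exact (Matrix.isUnit_iff_isUnit_det _).2
    (isUnit_of_mul_isUnit_right (isUnit_of_mul_isUnit_left h))

theorem core_inv_eq (s : Skeleton K m n r₁ q₁ q₂) :
    s.core⁻¹ = Matrix.diagonal s.colScale * s.weightedCore⁻¹ * Matrix.diagonal s.rowScale := by
  have hr : IsUnit (Matrix.diagonal s.rowScale).det := by
    rw [Matrix.det_diagonal]
    exact (Finset.prod_pos fun i _ => s.rowScale_pos i).ne'.isUnit
  have hc : IsUnit (Matrix.diagonal s.colScale).det := by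
    rw [Matrix.det_diagonal]
    exact (Finset.prod_pos fun i _ => s.colScale_pos i).ne'.isUnit
  rw [weightedCore_eq, Matrix.mul_inv_rev, Matrix.mul_inv_rev,
    Matrix.mul_nonsing_inv_cancel_left _ _ hc, Matrix.nonsing_inv_mul_cancel_right _ _ hr]

theorem norm_core_inv_le (s : Skeleton K m n r₁ q₁ q₂) :
    ‖s.core⁻¹‖ ≤ (Real.pi ^ d) ^ 2 * ‖s.weightedCore⁻¹‖ := by
  have hr : ‖Matrix.diagonal s.rowScale‖ ≤ Real.pi ^ d := by
    rw [Matrix.l2_opNorm_diagonal, pi_norm_le_iff_of_nonneg (by positivity)]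
    intro i
    rw [Real.norm_of_nonneg (s.rowScale_pos i).le]
    exact sqrt_gridWeight_le _ _
  have hc : ‖Matrix.diagonal s.colScale‖ ≤ Real.pi ^ d := by
    rw [Matrix.l2_opNorm_diagonal, pi_norm_le_iff_of_nonneg (by positivity)]
    intro i
    rw [Real.norm_of_nonneg (s.colScale_pos i).le]
    exact sqrt_gridWeight_le _ _
  rw [core_inv_eq]
  calc _ ≤ ‖Matrix.diagonal s.colScale‖ * ‖s.weightedCore⁻¹‖ * ‖Matrix.diagonal s.rowScale‖ :=
        (Matrix.l2_opNorm_mul _ _).trans (by gcongr; exact Matrix.l2_opNorm_mul _ _)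
    _ ≤ Real.pi ^ d * ‖s.weightedCore⁻¹‖ * Real.pi ^ d := by gcongr
    _ = _ := by ring

/-- The second factorization is exact. -/
theorem cols_eq_rowInterp_mul (s : Skeleton K m n r₁ q₁ q₂) :
    s.colQR.cols = s.rowInterp * s.weightedCore := by
  have h := s.rowQR.err_eq_zero (by simp) s.rowQR_strong.isUnit
  ext i j
  have h1 := congr_fun (congr_fun (sub_eq_zero.1 h) j) (s.rowQR.perm.symm i)
  simp only [Matrix.submatrix_apply, Matrix.transpose_apply, id_eq, Equiv.apply_symm_apply] at h1
  rw [h1, Matrix.mul_apply, Matrix.mul_apply]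
  refine Finset.sum_congr rfl fun l _ => ?_
  simp [rowInterp, weightedCore, PivotedQR.cols, mul_comm]

theorem errQR_eq (s : Skeleton K m n r₁ q₁ q₂) :
    s.errQR = s.colQR.err.submatrix s.rowQR.perm id := by
  have h : Matrix.fromRows (1 : Matrix (Fin r₁) (Fin r₁) ℝ) s.rowQR.interp.transpose *
      (weightedMatrix K m n).submatrix s.rowQR.sel s.colQR.sel =
      s.colQR.cols.submatrix s.rowQR.perm id := by
    ext i j
    refine Eq.trans ?_ (congr_fun (congr_fun s.cols_eq_rowInterp_mul (s.rowQR.perm i)) j).symm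
    simp only [Matrix.mul_apply, Matrix.submatrix_apply, rowInterp, Matrix.of_apply,
      Equiv.symm_apply_apply, weightedCore]
    refine Finset.sum_congr rfl fun l _ => ?_
    rcases i with i | i <;> simp [Matrix.one_apply, eq_comm]
  rw [errQR, h]
  rfl

theorem eps_nonneg (s : Skeleton K m n r₁ q₁ q₂) : 0 ≤ s.eps := norm_nonneg _

theorem rank_le_card_rows (s : Skeleton K m n r₁ q₁ q₂) : r₁ ≤ Fintype.card (Grid m) := by
  rw [s.rowQR.card_cols]
  omega

/-- The smallest singular value of the selected block is not much smaller than the accuracy. -/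
theorem norm_weightedCore_inv_mul_eps_le (s : Skeleton K m n r₁ q₁ q₂) {a : ℝ}
    (ha : |MvPolynomial.eval ![(Fintype.card (Grid n) : ℝ), (r₁ : ℝ)] q₁| ≤ a) :
    ‖s.weightedCore⁻¹‖ * s.eps ≤ a ^ 2 * ‖s.rowInterp‖ := by
  have ha0 : 0 ≤ a := (abs_nonneg _).trans ha
  have ha1 := (le_abs_self _).trans ha
  have hE : ‖s.eps • s.weightedCore⁻¹‖ ≤ a ^ 2 * ‖s.rowInterp‖ := by
    refine norm_le_of_forall_mulVec (by positivity) fun w => ?_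
    rcases r₁ with _ | k
    · have h0 : ∀ v : Fin 0 → ℝ, ‖WithLp.toLp 2 v‖ = 0 := fun v => by
        rw [EuclideanSpace.norm_eq]; simp
      rw [h0, h0]; simp
    · set v := s.weightedCore⁻¹.mulVec w with hv
      have hw : s.weightedCore.mulVec v = w := by
        rw [hv, Matrix.mulVec_mulVec, Matrix.mul_nonsing_inv _ s.isUnit_det_weightedCore,
          Matrix.one_mulVec]
      have heps : s.eps ≤ a ^ 2 * singVal s.colQR.cols k := by
        calc s.eps ≤ ‖s.colQR.err‖ := by
              rw [eps, errQR_eq]; exact norm_submatrix_left_le _ _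
          _ ≤ singVal s.colQR.err 0 := norm_le_singVal_zero _
          _ ≤ _ := s.colQR_strong.upper 0
          _ ≤ singVal (weightedMatrix K m n) (k + 1 + 0) * a := by
              gcongr; exact singVal_nonneg _ _
          _ ≤ singVal (weightedMatrix K m n) k * a := by
              gcongr; exact singVal_antitone _ (by omega)
          _ ≤ (a * singVal s.colQR.cols k) * a := by
              gcongr
              refine (s.colQR_strong.lower k (by omega)).trans ?_
              gcongr
              exact singVal_nonneg _ _
          _ = _ := by ring
      rw [Matrix.smul_mulVec, ← hv, WithLp.toLp_smul, norm_smul, Real.norm_of_nonneg s.eps_nonneg]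
      calc s.eps * ‖WithLp.toLp 2 v‖
          ≤ a ^ 2 * singVal s.colQR.cols k * ‖WithLp.toLp 2 v‖ := by gcongr
        _ = a ^ 2 * (singVal s.colQR.cols k * ‖WithLp.toLp 2 v‖) := by ring
        _ ≤ a ^ 2 * ‖WithLp.toLp 2 (s.colQR.cols.mulVec v)‖ := by
            gcongr; exact singVal_mul_norm_le _ (by simp) v
        _ = a ^ 2 * ‖WithLp.toLp 2 (s.rowInterp.mulVec w)‖ := by
            rw [cols_eq_rowInterp_mul, ← Matrix.mulVec_mulVec, hw]
        _ ≤ a ^ 2 * (‖s.rowInterp‖ * ‖WithLp.toLp 2 w‖) := by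
            gcongr; exact norm_toLp_mulVec_le _ _
        _ = _ := by ring
  rwa [norm_smul, Real.norm_of_nonneg s.eps_nonneg, mul_comm] at hE

/-- `K(X̄, Ŷ) = D K(X̂, Ŷ)`, with `D` the rescaled row interpolation operator. -/
theorem kernelMatrix_grid_Yhat (s : Skeleton K m n r₁ q₁ q₂) :
    kernelMatrix K (gridPoint m) s.Yhat =
      Matrix.of (fun i l => (Real.sqrt (gridWeight m i))⁻¹ * s.rowInterp i l * s.rowScale l) *
        s.core := by
  ext i j
  have h := congr_fun (congr_fun s.cols_eq_rowInterp_mul i) j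
  have hi := (Real.sqrt_pos.2 (gridWeight_pos m i)).ne'
  have hj := (s.colScale_pos j).ne'
  rw [PivotedQR.cols, Matrix.submatrix_apply, id_eq, weightedMatrix_apply, weightedCore_eq,
    Matrix.mul_apply] at h
  simp only [Matrix.mul_diagonal, Matrix.diagonal_mul] at h
  rw [show K (gridPoint m i) (gridPoint n (s.colQR.sel j)) =
    kernelMatrix K (gridPoint m) s.Yhat i j from rfl] at h
  change _ * s.colScale j = _ at h
  have h2 : kernelMatrix K (gridPoint m) s.Yhat i j = (Real.sqrt (gridWeight m i))⁻¹ *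
      (Real.sqrt (gridWeight m i) * kernelMatrix K (gridPoint m) s.Yhat i j * s.colScale j) *
      (s.colScale j)⁻¹ := by field_simp
  rw [h2, h, Matrix.mul_apply, Finset.mul_sum, Finset.sum_mul]
  refine Finset.sum_congr rfl fun l _ => ?_
  simp only [Matrix.of_apply]
  field_simp

/-- `K(X̂, Ȳ) = K(X̂, Ŷ) D + E`, with `D` the rescaled column interpolation operator. -/
theorem kernelMatrix_Xhat_grid (s : Skeleton K m n r₁ q₁ q₂) :
    kernelMatrix K s.Xhat (gridPoint n) =
      s.core * Matrix.of (fun l j =>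
        s.colScale l * s.colInterp l j * (Real.sqrt (gridWeight n j))⁻¹) +
      Matrix.of (fun i j => (s.rowScale i)⁻¹ * s.errQR (Sum.inl i) (s.colQR.perm.symm j) *
        (Real.sqrt (gridWeight n j))⁻¹) := by
  ext i j
  have hj := (Real.sqrt_pos.2 (gridWeight_pos n j)).ne'
  have hi := (s.rowScale_pos i).ne'
  have h : s.errQR (Sum.inl i) (s.colQR.perm.symm j) =
      weightedMatrix K m n (s.rowQR.sel i) j - (s.weightedCore * s.colInterp) i j := by
    rw [errQR, Matrix.sub_apply, Matrix.fromRows_mul, Matrix.one_mul, Matrix.fromRows_mul]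
    simp only [Matrix.submatrix_apply, Equiv.apply_symm_apply, Matrix.fromRows_apply_inl]
    rfl
  rw [Matrix.add_apply, Matrix.of_apply, h, weightedMatrix_apply, weightedCore_eq]
  change _ = _ + (s.rowScale i)⁻¹ * (s.rowScale i * kernelMatrix K s.Xhat (gridPoint n) i j *
    Real.sqrt (gridWeight n j) - _) * _
  have h3 : (s.core * Matrix.of (fun l j =>
      s.colScale l * s.colInterp l j * (Real.sqrt (gridWeight n j))⁻¹)) i j =
      (s.rowScale i)⁻¹ * (Matrix.diagonal s.rowScale * s.core * Matrix.diagonal s.colScale *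
        s.colInterp) i j * (Real.sqrt (gridWeight n j))⁻¹ := by
    rw [Matrix.mul_apply, Matrix.mul_apply, Finset.mul_sum, Finset.sum_mul]
    refine Finset.sum_congr rfl fun l _ => ?_
    simp only [Matrix.of_apply, Matrix.mul_diagonal, Matrix.diagonal_mul]
    field_simp
  rw [h3]
  field_simp
  ring

theorem kernelMatrix_point_Yhat (s : Skeleton K m n r₁ q₁ q₂) (x : Fin d → ℝ) :
    kernelMatrix K (fun _ : Unit => x) s.Yhat =
      Matrix.of (fun (_ : Unit) i => gridLagrange m i x) * kernelMatrix K (gridPoint m) s.Yhat +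
      Matrix.of (fun (_ : Unit) j => interpError K m n x (s.Yhat j)) := by
  ext u j
  simp only [Matrix.add_apply, Matrix.mul_apply, Matrix.of_apply, interpError, Yhat, kernelMatrix,
    gridLagrange_gridPoint]
  simp

theorem kernelMatrix_Xhat_point (s : Skeleton K m n r₁ q₁ q₂) (y : Fin d → ℝ) :
    kernelMatrix K s.Xhat (fun _ : Unit => y) =
      kernelMatrix K s.Xhat (gridPoint n) * Matrix.of (fun j (_ : Unit) => gridLagrange n j y) +
      Matrix.of (fun i (_ : Unit) => interpError K m n (s.Xhat i) y) := by
  ext i u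
  simp only [Matrix.add_apply, Matrix.mul_apply, Matrix.of_apply, interpError, Xhat, kernelMatrix,
    gridLagrange_gridPoint]
  rw [Finset.sum_comm]
  simp

end Skeleton

end SkelInterp

namespace SkelInterp

namespace Skeleton

variable {d : ℕ} {K : (Fin d → ℝ) → (Fin d → ℝ) → ℝ} {m n : Fin d → ℕ} {r₁ : ℕ}
  {q₁ q₂ : MvPolynomial (Fin 2) ℝ}

theorem abs_rowInterp_le (s : Skeleton K m n r₁ q₁ q₂) {t : ℝ}
    (ht : frobNorm s.rowQR.interp ≤ t) (i : Grid m) (l : Fin r₁) : |s.rowInterp i l| ≤ 1 + t :=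
  s.rowQR.abs_interp_extended_le ht l _

theorem abs_colInterp_le (s : Skeleton K m n r₁ q₁ q₂) {t : ℝ}
    (ht : frobNorm s.colQR.interp ≤ t) (l : Fin r₁) (j : Grid n) : |s.colInterp l j| ≤ 1 + t :=
  s.colQR.abs_interp_extended_le ht l _

/-- The bound for `ε ‖K(X̂, Ŷ)⁻¹‖`, where `N` bounds the grid sizes, `a` the quality of the
factorizations and `t` the interpolation operators. -/
noncomputable def invBound (d : ℕ) (N a t : ℝ) : ℝ :=
  (Real.pi ^ d) ^ 2 * (a ^ 2 * (N * N * (1 + t)))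

theorem norm_core_inv_mul_eps_le (s : Skeleton K m n r₁ q₁ q₂) {N a t : ℝ}
    (hN : (Fintype.card (Grid m) : ℝ) ≤ N)
    (ha : |MvPolynomial.eval ![(Fintype.card (Grid n) : ℝ), (r₁ : ℝ)] q₁| ≤ a)
    (ht : frobNorm s.rowQR.interp ≤ t) : ‖s.core⁻¹‖ * s.eps ≤ invBound d N a t := by
  have ht0 : 0 ≤ t := (Real.sqrt_nonneg _).trans ht
  have hr : (r₁ : ℝ) ≤ N := le_trans (by exact_mod_cast s.rank_le_card_rows) hN
  have hN0 : 0 ≤ N := le_trans (by positivity) hN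
  calc ‖s.core⁻¹‖ * s.eps ≤ (Real.pi ^ d) ^ 2 * ‖s.weightedCore⁻¹‖ * s.eps :=
        mul_le_mul_of_nonneg_right s.norm_core_inv_le s.eps_nonneg
    _ = (Real.pi ^ d) ^ 2 * (‖s.weightedCore⁻¹‖ * s.eps) := by ring
    _ ≤ (Real.pi ^ d) ^ 2 * (a ^ 2 * ‖s.rowInterp‖) :=
        mul_le_mul_of_nonneg_left (s.norm_weightedCore_inv_mul_eps_le ha) (by positivity)
    _ ≤ (Real.pi ^ d) ^ 2 *
          (a ^ 2 * (Fintype.card (Grid m) * Fintype.card (Fin r₁) * (1 + t))) := by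
        gcongr
        exact norm_le_card_mul_of_abs_entry_le _ (by linarith) (s.abs_rowInterp_le ht)
    _ ≤ _ := by
        rw [Fintype.card_fin, invBound]
        gcongr

theorem norm_leftOp_le (s : Skeleton K m n r₁ q₁ q₂) {N t c : ℝ}
    (hN : (Fintype.card (Grid m) : ℝ) ≤ N) (ht : frobNorm s.rowQR.interp ≤ t)
    (hc : ‖s.core⁻¹‖ * s.eps ≤ c) {x : Fin d → ℝ} (hx : x ∈ cube d)
    (herr : ∀ y ∈ cube d, |interpError K m n x y| ≤ s.eps) :
    ‖s.leftOp x‖ ≤ N * (N * (2 ^ d * (N * (1 + t) * Real.pi ^ d)) + N * c) := by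
  have ht0 : 0 ≤ t := (Real.sqrt_nonneg _).trans ht
  have hr : (r₁ : ℝ) ≤ N := le_trans (by exact_mod_cast s.rank_le_card_rows) hN
  have hN0 : 0 ≤ N := le_trans (by positivity) hN
  have hc0 : 0 ≤ c := (mul_nonneg (norm_nonneg _) s.eps_nonneg).trans hc
  have heps := s.eps_nonneg
  have hdet := (Matrix.isUnit_iff_isUnit_det _).1 s.isUnit_core
  have hop : s.leftOp x = Matrix.of (fun (_ : Unit) i => gridLagrange m i x) *
      Matrix.of (fun i l => (Real.sqrt (gridWeight m i))⁻¹ * s.rowInterp i l * s.rowScale l) +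
      Matrix.of (fun (_ : Unit) j => interpError K m n x (s.Yhat j)) * s.core⁻¹ := by
    rw [leftOp, kernelMatrix_point_Yhat, kernelMatrix_grid_Yhat, Matrix.add_mul,
      ← Matrix.mul_assoc, Matrix.mul_nonsing_inv_cancel_right _ _ hdet]
  have hentry : ∀ u j, |s.leftOp x u j| ≤
      N * (2 ^ d * (N * (1 + t) * Real.pi ^ d)) + N * c := by
    intro u j
    rw [hop, Matrix.add_apply]
    refine (abs_add_le _ _).trans (add_le_add ?_ ?_)
    · refine (abs_mul_apply_le _ _ (a := 2 ^ d) (b := N * (1 + t) * Real.pi ^ d) u j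
        (fun i => abs_gridLagrange_le m i hx) fun i => ?_).trans (by gcongr)
      rw [Matrix.of_apply, abs_mul, abs_mul, abs_of_nonneg (s.rowScale_pos j).le,
        abs_of_nonneg (inv_nonneg.2 (Real.sqrt_nonneg _))]
      have := s.rowScale_pos j
      gcongr
      · exact (inv_sqrt_gridWeight_le m i).trans hN
      · exact s.abs_rowInterp_le ht i j
      · exact sqrt_gridWeight_le _ _
    · refine (abs_mul_apply_le _ _ (a := s.eps) (b := ‖s.core⁻¹‖) u j
        (fun l => herr _ (gridPoint_mem_cube n _)) fun l => abs_entry_le_norm _ _ _).trans ?_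
      rw [Fintype.card_fin, mul_comm s.eps]
      gcongr
  refine (norm_le_card_mul_of_abs_entry_le _ (by positivity) hentry).trans ?_
  rw [Fintype.card_unit, Fintype.card_fin, Nat.cast_one, one_mul]
  gcongr

theorem norm_rightOp_le (s : Skeleton K m n r₁ q₁ q₂) {N t c : ℝ}
    (hNm : (Fintype.card (Grid m) : ℝ) ≤ N) (hNn : (Fintype.card (Grid n) : ℝ) ≤ N)
    (ht : frobNorm s.colQR.interp ≤ t)
    (hc : ‖s.core⁻¹‖ * s.eps ≤ c) {y : Fin d → ℝ} (hy : y ∈ cube d)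
    (herr : ∀ x ∈ cube d, |interpError K m n x y| ≤ s.eps) :
    ‖s.rightOp y‖ ≤ N * (N * (Real.pi ^ d * (1 + t) * N * 2 ^ d) +
      N * (c * (N * (N * N * 2 ^ d) + 1))) := by
  have ht0 : 0 ≤ t := (Real.sqrt_nonneg _).trans ht
  have hr : (r₁ : ℝ) ≤ N := le_trans (by exact_mod_cast s.rank_le_card_rows) hNm
  have hN0 : 0 ≤ N := le_trans (by positivity) hNm
  have hc0 : 0 ≤ c := (mul_nonneg (norm_nonneg _) s.eps_nonneg).trans hc
  have heps := s.eps_nonneg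
  have hdet := (Matrix.isUnit_iff_isUnit_det _).1 s.isUnit_core
  have hop : s.rightOp y = Matrix.of (fun l j =>
        s.colScale l * s.colInterp l j * (Real.sqrt (gridWeight n j))⁻¹) *
        Matrix.of (fun j (_ : Unit) => gridLagrange n j y) +
      s.core⁻¹ * (Matrix.of (fun i j => (s.rowScale i)⁻¹ *
          s.errQR (Sum.inl i) (s.colQR.perm.symm j) * (Real.sqrt (gridWeight n j))⁻¹) *
          Matrix.of (fun j (_ : Unit) => gridLagrange n j y) +
        Matrix.of (fun i (_ : Unit) => interpError K m n (s.Xhat i) y)) := by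
    rw [rightOp, kernelMatrix_Xhat_point, kernelMatrix_Xhat_grid, Matrix.add_mul, add_assoc,
      Matrix.mul_add, Matrix.mul_assoc s.core, Matrix.nonsing_inv_mul_cancel_left _ _ hdet]
  have hentry : ∀ i u, |s.rightOp y i u| ≤ N * (Real.pi ^ d * (1 + t) * N * 2 ^ d) +
      N * (c * (N * (N * N * 2 ^ d) + 1)) := by
    intro i u
    rw [hop, Matrix.add_apply]
    refine (abs_add_le _ _).trans (add_le_add ?_ ?_)
    · refine (abs_mul_apply_le _ _ (a := Real.pi ^ d * (1 + t) * N) (b := 2 ^ d) i u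
        (fun j => ?_) fun j => abs_gridLagrange_le n j hy).trans (by gcongr)
      rw [Matrix.of_apply, abs_mul, abs_mul, abs_of_nonneg (s.colScale_pos i).le,
        abs_of_nonneg (inv_nonneg.2 (Real.sqrt_nonneg _))]
      gcongr
      · exact sqrt_gridWeight_le _ _
      · exact s.abs_colInterp_le ht i j
      · exact (inv_sqrt_gridWeight_le n j).trans hNn
    · refine (abs_mul_apply_le _ _ (a := ‖s.core⁻¹‖)
        (b := s.eps * (N * (N * N * 2 ^ d) + 1)) i u
        (fun l => abs_entry_le_norm _ _ _) fun l => ?_).trans ?_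
      · rw [Matrix.add_apply, mul_add, mul_one]
        refine (abs_add_le _ _).trans
          (add_le_add ?_ (herr _ (gridPoint_mem_cube m _)))
        refine (abs_mul_apply_le _ _ (a := N * s.eps * N) (b := 2 ^ d) l u
          (fun j => ?_) fun j => abs_gridLagrange_le n j hy).trans ?_
        · rw [Matrix.of_apply, abs_mul, abs_mul, abs_of_nonneg (inv_nonneg.2 (s.rowScale_pos l).le),
            abs_of_nonneg (inv_nonneg.2 (Real.sqrt_nonneg _))]
          gcongr
          · exact (inv_sqrt_gridWeight_le m _).trans hNm
          · exact abs_entry_le_norm s.errQR _ _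
          · exact (inv_sqrt_gridWeight_le n j).trans hNn
        · calc _ ≤ N * (N * s.eps * N * 2 ^ d) := by gcongr
            _ = _ := by ring
      · rw [Fintype.card_fin, ← mul_assoc ‖s.core⁻¹‖]
        gcongr
  refine (norm_le_card_mul_of_abs_entry_le _ (by positivity) hentry).trans ?_
  rw [Fintype.card_unit, Fintype.card_fin, Nat.cast_one, mul_one]
  gcongr

end Skeleton

end SkelInterp

/-- `q₁`, `q₂` are the polynomials of the strong rank-revealing QR factorizations; `B`, `b` say
that the sizes of the two grids are polynomially comparable. The polynomial `q` and the constant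
`C` depend on nothing else but the dimension. -/
theorem lemma4 (d : ℕ) (q₁ q₂ : MvPolynomial (Fin 2) ℝ) (B b : ℕ) :
    ∃ (q : MvPolynomial (Fin 2) ℝ) (C : ℝ), 0 < C ∧
      ∀ (K : (Fin d → ℝ) → (Fin d → ℝ) → ℝ) (m n : Fin d → ℕ) (r₁ : ℕ)
        (s : SkelInterp.Skeleton K m n r₁ q₁ q₂) (δ : ℝ),
        (∀ i, 0 < m i) → (∀ i, 0 < n i) →
        max (Fintype.card (SkelInterp.Grid m)) (Fintype.card (SkelInterp.Grid n)) ≤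
          B * SkelInterp.interpRank m n ^ b →
        (∀ x ∈ SkelInterp.cube d, ∀ y ∈ SkelInterp.cube d,
          |SkelInterp.interpError K m n x y| ≤ δ) →
        δ ≤ s.eps →
        IsUnit s.core ∧
        (∀ x ∈ SkelInterp.cube d, ∀ y ∈ SkelInterp.cube d,
          ‖s.leftOp x‖ ≤
            C * MvPolynomial.eval ![(SkelInterp.interpRank m n : ℝ), (r₁ : ℝ)] q ∧
          ‖s.rightOp y‖ ≤
            C * MvPolynomial.eval ![(SkelInterp.interpRank m n : ℝ), (r₁ : ℝ)] q) ∧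
        SkelInterp.condNumber s.core * s.eps ≤
          C * MvPolynomial.eval ![(SkelInterp.interpRank m n : ℝ), (r₁ : ℝ)] q * ‖s.core‖ := by
  let N : MvPolynomial (Fin 2) ℝ := MvPolynomial.C (B : ℝ) * MvPolynomial.X 0 ^ b
  let a := MvPolynomial.bind₁ ![N, MvPolynomial.X 1] (SkelInterp.absPoly q₁)
  let t := MvPolynomial.bind₁ ![N, MvPolynomial.X 1] (SkelInterp.absPoly q₂)
  let w : MvPolynomial (Fin 2) ℝ := MvPolynomial.C (Real.pi ^ d)
  let v : MvPolynomial (Fin 2) ℝ := MvPolynomial.C (2 ^ d)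
  let c := w ^ 2 * (a ^ 2 * (N * N * (1 + t)))
  refine ⟨N * (N * (w * (1 + t) * N * v) + N * (c * (N * (N * N * v) + 1))) + c, 1, one_pos, ?_⟩
  intro K m n r₁ s δ _ _ hcard herr hδ
  set x : Fin 2 → ℝ := ![(SkelInterp.interpRank m n : ℝ), (r₁ : ℝ)] with hx
  set N' : ℝ := B * (SkelInterp.interpRank m n : ℝ) ^ b with hN'
  set a' : ℝ := MvPolynomial.eval ![N', (r₁ : ℝ)] (SkelInterp.absPoly q₁) with ha'
  set t' : ℝ := MvPolynomial.eval ![N', (r₁ : ℝ)] (SkelInterp.absPoly q₂) with ht'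
  have hNm : (Fintype.card (SkelInterp.Grid m) : ℝ) ≤ N' := by
    rw [hN']
    exact_mod_cast (le_max_left _ _).trans hcard
  have hNn : (Fintype.card (SkelInterp.Grid n) : ℝ) ≤ N' := by
    rw [hN']
    exact_mod_cast (le_max_right _ _).trans hcard
  have hNe : MvPolynomial.eval x N = N' := by simp [N, hx, hN']
  have hbind : ∀ p, MvPolynomial.eval x (MvPolynomial.bind₁ ![N, MvPolynomial.X 1] p) =
      MvPolynomial.eval ![N', (r₁ : ℝ)] p := by
    intro p
    rw [← MvPolynomial.coe_aeval_eq_eval, RingHom.coe_coe, MvPolynomial.aeval_bind₁,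
      ← MvPolynomial.coe_aeval_eq_eval, RingHom.coe_coe]
    congr 2
    funext i
    fin_cases i
    · simpa using hNe
    · simp [hx]
  have hae : MvPolynomial.eval x a = a' := hbind _
  have hte : MvPolynomial.eval x t = t' := hbind _
  have hpoly : ∀ (p : MvPolynomial (Fin 2) ℝ) (k : ℕ), (k : ℝ) ≤ N' →
      |MvPolynomial.eval ![(k : ℝ), (r₁ : ℝ)] p| ≤
        MvPolynomial.eval ![N', (r₁ : ℝ)] (SkelInterp.absPoly p) := by
    intro p k hk
    refine SkelInterp.abs_eval_le_eval_absPoly p (fun i => ?_) fun i => ?_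
    · fin_cases i <;> simp
    · fin_cases i <;> simp [hk]
  have ht1 : SkelInterp.frobNorm s.colQR.interp ≤ t' :=
    s.colQR_strong.interp_le.trans ((le_abs_self _).trans (hpoly q₂ _ hNn))
  have ht2 : SkelInterp.frobNorm s.rowQR.interp ≤ t' :=
    s.rowQR_strong.interp_le.trans ((le_abs_self _).trans (hpoly q₂ _ hNm))
  have ht0 : 0 ≤ t' := (Real.sqrt_nonneg _).trans ht1
  have hN0 : 0 ≤ N' := by positivity
  have hinv := s.norm_core_inv_mul_eps_le hNm (hpoly q₁ _ hNn) ht2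
  set c' : ℝ := SkelInterp.Skeleton.invBound d N' a' t' with hc'
  have hc0 : 0 ≤ c' := (mul_nonneg (norm_nonneg _) s.eps_nonneg).trans hinv
  have hce : MvPolynomial.eval x c = c' := by
    simp only [c, w, map_mul, map_pow, map_add, map_one, MvPolynomial.eval_C, hNe, hae, hte]
    rfl
  have hq : MvPolynomial.eval x
      (N * (N * (w * (1 + t) * N * v) + N * (c * (N * (N * N * v) + 1))) + c) =
      N' * (N' * (Real.pi ^ d * (1 + t') * N' * 2 ^ d) +
        N' * (c' * (N' * (N' * N' * 2 ^ d) + 1))) + c' := by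
    simp only [w, v, map_mul, map_add, map_one, MvPolynomial.eval_C, hNe, hte, hce]
  rw [hq, one_mul]
  refine ⟨s.isUnit_core, fun x hx y hy => ⟨?_, ?_⟩, ?_⟩
  · refine (s.norm_leftOp_le hNm ht2 hinv hx fun y hy => (herr x hx y hy).trans hδ).trans ?_
    have h1 : c' ≤ c' * (N' * (N' * N' * 2 ^ d) + 1) :=
      le_mul_of_one_le_right hc0 (by linarith [show 0 ≤ N' * (N' * N' * 2 ^ d) by positivity])
    have h2 : N' * (N' * (2 ^ d * (N' * (1 + t') * Real.pi ^ d)) + N' * c') ≤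
        N' * (N' * (Real.pi ^ d * (1 + t') * N' * 2 ^ d) +
          N' * (c' * (N' * (N' * N' * 2 ^ d) + 1))) := by
      gcongr N' * (N' * ?_ + N' * ?_)
      exact le_of_eq (by ring)
    linarith
  · refine (s.norm_rightOp_le hNm hNn ht1 hinv hy fun x hx => (herr x hx y hy).trans hδ).trans ?_
    linarith
  · rw [SkelInterp.condNumber, mul_assoc, mul_comm]
    refine mul_le_mul_of_nonneg_right (hinv.trans (le_add_of_nonneg_left ?_)) (norm_nonneg _)
    positivity
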